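/- Let $G$ be a finite simple undirected graph with $n\ge 4$ vertices, minimum degree at least $1$, and at least $\binom{n-2}{2}+2$ edges. Then $G$ contains a Hamilton path if and only if $G$ is not isomorphic to any of the nine graphs $$K_1\vee(K_{n-3}+2K_1),\quad K_1\vee(K_{1,3}+K_1),\quad K_{2,4},\quad K_2\vee 4K_1,\quad K_2\vee(3K_1+K_2),$$ $$K_1\vee K_{2,5},\quad K_3\vee 5K_1,\quad K_2\vee(K_{1,4}+K_1),\quad K_4\vee 6K_1 .$$ Here $H_1+H_2$ denotes the disjoint union of two graphs, $kH$ the disjoint union of $k$ copies of $H$, and $H_1\vee H_2$ the join, obtained from $H_1+H_2$ by joining every vertex of $H_1$ to every vertex of $H_2$; $K_r$ is the complete graph on $r$ vertices and $K_{a,b}$ the complete bipartite graph with parts of sizes $a$ and $b$. -/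

import Mathlib

/-- The join `G ∨ H`: the disjoint union of `G` and `H` together with all the edges between
the two vertex sets. -/
def SimpleGraph.join {V W : Type*} (G : SimpleGraph V) (H : SimpleGraph W) :
    SimpleGraph (V ⊕ W) :=
  (G ⊕g H) ⊔ completeBipartiteGraph V W

/-- The complete graph `K_n`. -/
abbrev completeG (n : ℕ) : SimpleGraph (Fin n) := ⊤

/-- The edgeless graph `n K_1` on `n` vertices. -/
abbrev edgelessG (n : ℕ) : SimpleGraph (Fin n) := ⊥

/-- The complete bipartite graph `K_{a,b}`. -/
abbrev completeBipG (a b : ℕ) : SimpleGraph (Fin a ⊕ Fin b) :=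
  completeBipartiteGraph (Fin a) (Fin b)

/-- `G` has a Hamilton path: a walk that visits every vertex exactly once. -/
def SimpleGraph.HasHamiltonPath {V : Type*} [DecidableEq V] (G : SimpleGraph V) : Prop :=
  ∃ (u v : V) (p : G.Walk u v), p.IsHamiltonian

/-- Membership up to isomorphism in the list of exceptional graphs of order `n`. The members are,
in this order, `K_1 ∨ (K_{n-3} + 2K_1)`, `K_1 ∨ (K_{1,3} + K_1)`, `K_{2,4}`, `K_2 ∨ 4K_1`,
`K_2 ∨ (3K_1 + K_2)`, `K_1 ∨ K_{2,5}`, `K_3 ∨ 5K_1`, `K_2 ∨ (K_{1,4} + K_1)`, `K_4 ∨ 6K_1`. -/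
def IsExceptional {V : Type*} (n : ℕ) (G : SimpleGraph V) : Prop :=
  Nonempty (G ≃g (completeG 1).join (completeG (n - 3) ⊕g edgelessG 2)) ∨
  Nonempty (G ≃g (completeG 1).join (completeBipG 1 3 ⊕g completeG 1)) ∨
  Nonempty (G ≃g completeBipG 2 4) ∨
  Nonempty (G ≃g (completeG 2).join (edgelessG 4)) ∨
  Nonempty (G ≃g (completeG 2).join (edgelessG 3 ⊕g completeG 2)) ∨
  Nonempty (G ≃g (completeG 1).join (completeBipG 2 5)) ∨
  Nonempty (G ≃g (completeG 3).join (edgelessG 5)) ∨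
  Nonempty (G ≃g (completeG 2).join (completeBipG 1 4 ⊕g completeG 1)) ∨
  Nonempty (G ≃g (completeG 4).join (edgelessG 6))

namespace SimpleGraph

/-! Deleting `k` vertices from a graph with a Hamilton path leaves at most `k + 1` components; each
exceptional graph violates this.

Conversely, extend `G` without Hamilton path to an edge-maximal such graph `H`. An Ore-type crossing
argument bounds the degree sum of nonadjacent vertices of `H` by `n - 2`. Taking a nonadjacent pair
of largest degree sum, with smaller degree `h`, gives `h + 1` vertices of degree at most `h`, and `h
+ 2` of them if `n = 2h + 2`. Counting edges around this set against `(n-2).choose 2 + 2` leaves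
only `h = 1`, or `h = 2` with `n = 7`, or `n = 2h + 2` with `h = 2, 3, 4`.

In the first two cases the count is tight, which forces `G = H = K_h ∨ (K_{n-2h-1} + (h+1)K_1)`. In
the last, `G` is `K_h ∨ (h+2)K_1`, or for `h ≤ 3` that graph minus one edge. These are the nine
graphs. -/

theorem hasHamiltonPath_iff_exists_list {V : Type*} [DecidableEq V] [Nonempty V]
    (G : SimpleGraph V) :
    G.HasHamiltonPath ↔ ∃ l : List V, l.IsChain G.Adj ∧ l.Nodup ∧ ∀ v, v ∈ l := by
  constructor
  · rintro ⟨u, v, p, hp⟩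
    exact ⟨p.support, p.isChain_adj_support, hp.isPath.support_nodup, hp.mem_support⟩
  · rintro ⟨l, hc, hn, hm⟩
    have hne : l ≠ [] := List.ne_nil_of_mem (hm (Classical.arbitrary V))
    refine ⟨_, _, Walk.ofSupport l hne hc, fun a => ?_⟩
    rw [Walk.support_ofSupport]
    exact List.count_eq_one_of_mem hn (hm a)

/-! ### Component obstruction and isomorphism of blow-ups -/

/-- Along a path, colour the vertices outside a deleted set so that adjacent remaining vertices
have the same colour: the number of colours exceeds the number of deleted vertices by at most
one. -/
theorem card_colors_le_of_isChain {V κ : Type*} [DecidableEq κ] {G : SimpleGraph V}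
    {c : V → Option κ} (hc : ∀ x y a b, G.Adj x y → c x = some a → c y = some b → a = b) :
    ∀ l : List V, l.IsChain G.Adj →
      (l.filterMap c).toFinset.card ≤ (l.filter fun v => (c v).isNone).length + 1 ∧
      -- The sharper bound is needed in the induction: prepending a coloured vertex to a list that
      -- starts with a deleted one may add a colour.
      ∀ v t, l = v :: t → c v = none →
        (l.filterMap c).toFinset.card ≤ (l.filter fun v => (c v).isNone).length
  | [], _ => by simp
  | [v], _ => by
      cases h : c v <;> simp [h]
  | v :: w :: t, hl => by
      rw [List.isChain_cons_cons] at hl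
      obtain ⟨ih₁, ih₂⟩ := card_colors_le_of_isChain hc (w :: t) hl.2
      cases h : c v with
      | none =>
        rw [List.filterMap_cons_none h, List.filter_cons_of_pos (by simp [h]), List.length_cons]
        exact ⟨by omega, fun _ _ _ _ => ih₁⟩
      | some a =>
        rw [List.filterMap_cons_some h, List.filter_cons_of_neg (by simp [h])]
        refine ⟨?_, fun v' t' e h' => by simp_all⟩
        cases h' : c w with
        | none =>
          have := ih₂ w t rfl h'
          rw [List.toFinset_cons]
          exact (Finset.card_insert_le _ _).trans (by omega)
        | some b =>
          obtain rfl := hc v w a b hl.1 h h'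
          rw [List.toFinset_cons, Finset.insert_eq_of_mem]
          · exact ih₁
          · rw [List.mem_toFinset, List.mem_filterMap]
            exact ⟨w, by simp, h'⟩

/-- The colour `none` marks deleted vertices; each other colour class is a union of components of
what remains. -/
theorem HasHamiltonPath.card_le {V κ : Type*} [Fintype V] [DecidableEq V] [Fintype κ]
    [DecidableEq κ] {G : SimpleGraph V} (hG : G.HasHamiltonPath) (c : V → Option κ)
    (hc : ∀ x y a b, G.Adj x y → c x = some a → c y = some b → a = b)
    (hs : ∀ a, ∃ v, c v = some a) :
    Fintype.card κ ≤ Fintype.card {v // c v = none} + 1 := by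
  obtain ⟨u, v, p, hp⟩ := hG
  have h := (card_colors_le_of_isChain hc p.support p.isChain_adj_support).1
  have h₁ : (p.support.filterMap c).toFinset = Finset.univ := by
    ext a
    obtain ⟨v, hv⟩ := hs a
    simpa [List.mem_filterMap] using ⟨v, hp.mem_support v, hv⟩
  have h₂ : (p.support.filter fun v => (c v).isNone).length =
      Fintype.card {v // c v = none} := by
    rw [← List.toFinset_card_of_nodup (hp.isPath.support_nodup.filter _), Fintype.card_subtype]
    congr 1
    ext w
    simp [hp.mem_support w]
  rwa [h₁, h₂, Finset.card_univ] at h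

theorem not_hasHamiltonPath_of_iso {V W κ : Type*} [DecidableEq V] [Fintype W]
    [DecidableEq W] [Fintype κ] [DecidableEq κ] {G : SimpleGraph V} {H : SimpleGraph W}
    (e : Nonempty (G ≃g H)) (c : W → Option κ)
    (hc : ∀ x y a b, H.Adj x y → c x = some a → c y = some b → a = b)
    (hs : ∀ a, ∃ v, c v = some a)
    (hcard : Fintype.card {v // c v = none} + 1 < Fintype.card κ) : ¬ G.HasHamiltonPath := by
  rintro ⟨u, v, p, hp⟩
  obtain ⟨e⟩ := e
  exact hcard.not_ge (HasHamiltonPath.card_le ⟨_, _, p.map e.toHom, hp.map e.toHom e.bijective⟩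
    c hc hs)

/-- Two graphs that are blow-ups of the same relation with classes of equal sizes are
isomorphic. -/
theorem nonempty_iso_of_coloring {V W κ : Type*} [Fintype V] [Fintype W] [DecidableEq κ]
    {G : SimpleGraph V} {H : SimpleGraph W} (M : κ → κ → Prop) (c : V → κ) (d : W → κ)
    (hG : ∀ x y, G.Adj x y ↔ x ≠ y ∧ M (c x) (c y))
    (hH : ∀ x y, H.Adj x y ↔ x ≠ y ∧ M (d x) (d y))
    (hcard : ∀ k, (Finset.univ.filter fun v => c v = k).card =
      (Finset.univ.filter fun w => d w = k).card) : Nonempty (G ≃g H) := by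
  have he (k : κ) : Nonempty ({v // c v = k} ≃ {w // d w = k}) := by
    refine ⟨Fintype.equivOfCardEq ?_⟩
    rw [Fintype.card_subtype, Fintype.card_subtype, hcard]
  let e := Equiv.ofFiberEquiv fun k => (he k).some
  have hd (x : V) : d (e x) = c x := Equiv.ofFiberEquiv_map _ x
  refine ⟨⟨e, fun {x y} => ?_⟩⟩
  rw [hG, hH, hd, hd, e.injective.ne_iff]

/-! ### Ore-type degree bound -/

/-- The successor of an entry satisfying `P` fails `Q`, so the shifted `P`-positions and the
`Q`-positions are disjoint among the `length - 1` non-head positions; the last and first entries are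
accounted for separately. -/
theorem countP_add_countP_le_of_isChain {V : Type*} (P Q : V → Bool) :
    ∀ (l : List V) (hl : l ≠ []), l.IsChain (fun x y => ¬(P x ∧ Q y)) →
      l.countP P + l.countP Q + 1 ≤
        l.length + (P (l.getLast hl)).toNat + (Q (l.head hl)).toNat
  | [], hl, _ => absurd rfl hl
  | [v], _, _ => by cases h : P v <;> cases h' : Q v <;> simp [h, h']
  | v :: w :: t, _, h => by
      rw [List.isChain_cons_cons] at h
      have ih := countP_add_countP_le_of_isChain P Q (w :: t) (by simp) h.2
      rw [List.getLast_cons (by simp), List.countP_cons (a := v), List.countP_cons (a := v)]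
      simp only [List.head_cons, List.length_cons] at ih ⊢
      cases hP : P v <;> cases hQ : Q v <;> cases hw : Q w <;> simp_all <;> omega

theorem exists_append_of_not_isChain {V : Type*} {R : V → V → Prop} {l : List V}
    (h : ¬ l.IsChain R) : ∃ l₁ a b l₂, l = (l₁ ++ [a]) ++ b :: l₂ ∧ ¬ R a b := by
  rw [List.isChain_iff_forall_rel_of_append_cons_cons] at h
  push Not at h
  obtain ⟨a, b, l₁, l₂, e, hR⟩ := h
  exact ⟨l₁, a, b, l₂, by simp [e], hR⟩

theorem degree_eq_countP {V : Type*} [Fintype V] (G : SimpleGraph V) [DecidableRel G.Adj]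
    {l : List V} (hn : l.Nodup) (hm : ∀ v, v ∈ l) (u : V) :
    G.degree u = l.countP fun v => G.Adj u v := by
  classical
  rw [List.countP_eq_length_filter, ← List.toFinset_card_of_nodup (hn.filter _),
    ← card_neighborFinset_eq_degree]
  congr 1
  ext v
  simp [hm v]

/-- If the vertices split into a path ending at `a` and a path starting at `b`, and `a`, `b` are
nonadjacent vertices with large degree sum, then there is a Hamilton path. -/
theorem degree_add_degree_le_of_two_paths {V : Type*} [Fintype V] [DecidableEq V]
    {G : SimpleGraph V} [DecidableRel G.Adj] (hG : ¬ G.HasHamiltonPath) {A B : List V} {a b : V}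
    (hA : (A ++ [a]).IsChain G.Adj) (hB : (b :: B).IsChain G.Adj)
    (hn : ((A ++ [a]) ++ b :: B).Nodup) (hm : ∀ v, v ∈ (A ++ [a]) ++ b :: B) :
    G.degree a + G.degree b + 2 ≤ Fintype.card V := by
  have : Nonempty V := ⟨a⟩
  rw [hasHamiltonPath_iff_exists_list] at hG
  push Not at hG
  have key (l : List V) (hl : l.Perm ((A ++ [a]) ++ b :: B)) : ¬ l.IsChain G.Adj := by
    intro hc
    obtain ⟨v, hv⟩ := hG l hc (hl.nodup_iff.2 hn)
    exact hv (hl.mem_iff.2 (hm v))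
  have rev {l : List V} (hl : l.IsChain G.Adj) : l.reverse.IsChain G.Adj := by
    rw [List.isChain_reverse]
    exact hl.imp fun _ _ h => h.symm
  have hlen : ((A ++ [a]) ++ b :: B).length = Fintype.card V := by
    rw [← List.toFinset_card_of_nodup hn, ← Finset.card_univ]
    congr 1
    rw [Finset.eq_univ_iff_forall]
    exact fun v => List.mem_toFinset.2 (hm v)
  -- Otherwise reversing the segment from `b` to `x` gives the Hamilton path `A, a, x, …, b, y, …`.
  have hB' : (b :: B).IsChain
      (fun x y => ¬ (decide (G.Adj a x) = true ∧ decide (G.Adj b y) = true)) := by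
    by_contra hcon
    obtain ⟨l₁, x, y, l₂, e, hxy⟩ := exists_append_of_not_isChain hcon
    simp only [decide_eq_true_eq, not_not] at hxy
    have hhead : (l₁ ++ [x]).head? = some b := by
      have := congrArg List.head? e
      rw [List.head?_append_of_ne_nil _ (by simp)] at this
      exact this.symm
    rw [e] at key hB
    refine key ((A ++ [a]) ++ ((l₁ ++ [x]).reverse ++ y :: l₂)) (by
      refine List.Perm.append_left _ (List.Perm.append_right _ (List.reverse_perm _))) ?_
    rw [List.isChain_append] at hB
    rw [List.isChain_append (l₁ := A ++ [a]), List.isChain_append (l₁ := (l₁ ++ [x]).reverse)]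
    refine ⟨hA, ⟨rev hB.1, hB.2.1, ?_⟩, ?_⟩
    · intro p hp q hq
      rw [List.getLast?_reverse, hhead] at hp
      simp only [Option.mem_def, Option.some.injEq, List.head?_cons] at hp hq
      subst hp hq
      exact hxy.2
    · intro p hp q hq
      simp at hp hq
      subst hp hq
      exact hxy.1
  -- Symmetrically, reversing the segment from `y` to `a` gives `…, x, a, …, y, b, B`.
  have hA' : (A ++ [a]).IsChain
      (fun x y => ¬ (decide (G.Adj a x) = true ∧ decide (G.Adj b y) = true)) := by
    by_contra hcon
    obtain ⟨l₁, x, y, l₂, e, hxy⟩ := exists_append_of_not_isChain hcon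
    simp only [decide_eq_true_eq, not_not] at hxy
    have hlast : (y :: l₂).getLast? = some a := by
      have := congrArg List.getLast? e
      simpa using this.symm
    rw [e] at key hA
    refine key (((l₁ ++ [x]) ++ (y :: l₂).reverse) ++ b :: B) (by
      refine List.Perm.append_right _ (List.Perm.append_left _ (List.reverse_perm _))) ?_
    rw [List.isChain_append] at hA
    rw [List.isChain_append, List.isChain_append]
    refine ⟨⟨hA.1, rev hA.2.1, ?_⟩, hB, ?_⟩
    · intro p hp q hq
      rw [List.head?_reverse, hlast] at hq
      simp at hp hq
      subst hp hq
      exact hxy.1.symm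
    · intro p hp q hq
      rw [List.getLast?_append_of_ne_nil _ (by simp), List.getLast?_reverse] at hp
      simp at hp hq
      subst hp hq
      exact hxy.2.symm
  have h₁ : ¬ G.Adj a ((b :: B).getLast (by simp)) := by
    intro h
    refine key ((A ++ [a]) ++ (b :: B).reverse) (List.Perm.append_left _ (List.reverse_perm _)) ?_
    rw [List.isChain_append]
    refine ⟨hA, rev hB, ?_⟩
    intro p hp q hq
    rw [List.head?_reverse, List.getLast?_eq_getLast_of_ne_nil (by simp)] at hq
    simp at hp hq
    subst hp hq
    exact h
  have h₂ : ¬ G.Adj b ((A ++ [a]).head (by simp)) := by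
    intro h
    refine key ((A ++ [a]).reverse ++ b :: B) (List.Perm.append_right _ (List.reverse_perm _)) ?_
    rw [List.isChain_append]
    refine ⟨rev hA, hB, ?_⟩
    intro p hp q hq
    rw [List.getLast?_reverse, List.head?_eq_some_head (by simp)] at hp
    simp only [Option.mem_def, Option.some.injEq, List.head?_cons] at hp hq
    subst hp hq
    exact h.symm
  have c₁ := countP_add_countP_le_of_isChain _ _ _ (by simp) hA'
  have c₂ := countP_add_countP_le_of_isChain _ _ _ (by simp) hB'
  rw [degree_eq_countP G hn hm, degree_eq_countP G hn hm, ← hlen,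
    List.length_append (as := A ++ [a]), List.countP_append (l₁ := A ++ [a]),
    List.countP_append (l₁ := A ++ [a])]
  simp only [h₁, h₂, decide_false, Bool.toNat_false, List.getLast_append_singleton, List.head_cons,
    SimpleGraph.irrefl] at c₁ c₂
  omega

/-- Ore's condition in an edge-maximal graph without Hamilton path. -/
theorem degree_add_degree_le_of_maximal {V : Type*} [Fintype V] [DecidableEq V]
    {G : SimpleGraph V} [DecidableRel G.Adj]
    (hG : Maximal (fun H : SimpleGraph V => ¬ H.HasHamiltonPath) G) {u v : V} (huv : u ≠ v)
    (hadj : ¬ G.Adj u v) : G.degree u + G.degree v + 2 ≤ Fintype.card V := by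
  have : Nonempty V := ⟨u⟩
  have hlt : G < G ⊔ edge u v := G.lt_sup_edge _ _ huv hadj
  have hH : (G ⊔ edge u v).HasHamiltonPath := by
    by_contra h
    exact hlt.not_ge (hG.2 h hlt.le)
  rw [hasHamiltonPath_iff_exists_list] at hH
  obtain ⟨l, hc, hn, hm⟩ := hH
  have hl : ¬ l.IsChain G.Adj := fun h =>
    hG.1 ((hasHamiltonPath_iff_exists_list G).2 ⟨l, h, hn, hm⟩)
  obtain ⟨A, a, b, B, rfl, hab⟩ := exists_append_of_not_isChain hl
  rw [List.isChain_append] at hc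
  have hab' := hc.2.2 a (by simp) b (by simp)
  simp only [sup_adj, edge_adj, hab, false_or] at hab'
  have hdis := List.nodup_append.1 hn
  -- The added edge is `ab`, and neither piece contains both ends, so both pieces are paths in `G`.
  have hA : (A ++ [a]).IsChain G.Adj := by
    refine hc.1.imp_of_mem_imp fun x y hx hy h => ?_
    have h₁ := hdis.2.2 x hx b (by simp)
    have h₂ := hdis.2.2 y hy b (by simp)
    simp only [sup_adj, edge_adj] at h
    grind
  have hB : (b :: B).IsChain G.Adj := by
    refine hc.2.1.imp_of_mem_imp fun x y hx hy h => ?_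
    have h₁ := hdis.2.2 a (by simp) x hx
    have h₂ := hdis.2.2 a (by simp) y hy
    simp only [sup_adj, edge_adj] at h
    grind
  have := degree_add_degree_le_of_two_paths hG.1 hA hB hn hm
  rcases hab'.1 with ⟨rfl, rfl⟩ | ⟨rfl, rfl⟩ <;> omega

/-! ### Edge counting and low-degree vertices -/

open Finset in
/-- Counting the edges of a graph by a set `S` of vertices of degree at most `h`. -/
theorem two_mul_card_edgeFinset_add {V : Type*} [Fintype V] [DecidableEq V] (G : SimpleGraph V)
    [DecidableRel G.Adj] (S : Finset V) (h : ℕ) (hS : ∀ s ∈ S, G.degree s ≤ h) :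
    2 * #G.edgeFinset + #{p ∈ S ×ˢ S | G.Adj p.1 p.2} + #{p ∈ Sᶜ.offDiag | ¬ G.Adj p.1 p.2} +
      2 * ∑ s ∈ S, (h - G.degree s) = 2 * (h * #S) + #Sᶜ * (#Sᶜ - 1) := by
  -- Ordered adjacent pairs: twice the edge number is twice the degree sum over `S`, minus `N S S`,
  -- plus `N Sᶜ Sᶜ`.
  let N (A B : Finset V) : ℕ := ∑ x ∈ A, ∑ y ∈ B, if G.Adj x y then 1 else 0
  have hdeg (A : Finset V) : ∑ x ∈ A, G.degree x = N A S + N A Sᶜ := by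
    rw [← sum_add_distrib]
    refine sum_congr rfl fun x _ => ?_
    rw [sum_add_sum_compl, ← card_neighborFinset_eq_degree, neighborFinset_eq_filter, card_filter]
  have hcomm : N Sᶜ S = N S Sᶜ := by
    simp only [N]
    rw [sum_comm]
    simp only [G.adj_comm]
  have htot : 2 * #G.edgeFinset = ∑ x ∈ S, G.degree x + ∑ x ∈ Sᶜ, G.degree x := by
    rw [sum_add_sum_compl, sum_degrees_eq_twice_card_edges]
  have hSS : #{p ∈ S ×ˢ S | G.Adj p.1 p.2} = N S S := by
    rw [card_filter, sum_product]
  have hTT : #{p ∈ Sᶜ.offDiag | G.Adj p.1 p.2} = N Sᶜ Sᶜ := by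
    have hN : N Sᶜ Sᶜ = #{p ∈ Sᶜ ×ˢ Sᶜ | G.Adj p.1 p.2} := by rw [card_filter, sum_product]
    rw [hN]
    congr 1
    ext ⟨x, y⟩
    simp only [mem_filter, mem_offDiag, mem_product]
    exact ⟨fun h => ⟨⟨h.1.1, h.1.2.1⟩, h.2⟩, fun h => ⟨⟨h.1.1, h.1.2, h.2.ne⟩, h.2⟩⟩
  have hoff := card_filter_add_card_filter_not (s := Sᶜ.offDiag) (fun p => G.Adj p.1 p.2)
  have hdef : ∑ s ∈ S, (h - G.degree s) + ∑ s ∈ S, G.degree s = h * #S := by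
    rw [← sum_add_distrib, sum_congr rfl fun s hs => Nat.sub_add_cancel (hS s hs), sum_const,
      smul_eq_mul, mul_comm]
  rw [offDiag_card, ← Nat.mul_sub_one] at hoff
  have h₁ := hdeg S
  have h₂ := hdeg Sᶜ
  omega

theorem exists_maximal_of_not_hasHamiltonPath {V : Type*} [Finite V] [DecidableEq V]
    {G : SimpleGraph V} (hG : ¬ G.HasHamiltonPath) :
    ∃ H, G ≤ H ∧ Maximal (fun H : SimpleGraph V => ¬ H.HasHamiltonPath) H :=
  Finite.exists_le_maximal hG

theorem exists_not_adj_of_not_hasHamiltonPath {V : Type*} [Fintype V] [DecidableEq V] [Nonempty V]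
    {G : SimpleGraph V} (hG : ¬ G.HasHamiltonPath) : ∃ u v, u ≠ v ∧ ¬ G.Adj u v := by
  by_contra! h
  refine hG ((hasHamiltonPath_iff_exists_list G).2
    ⟨Finset.univ.toList, ?_, Finset.nodup_toList _, by simp⟩)
  exact List.Pairwise.isChain ((Finset.nodup_toList _).imp fun hxy => h _ _ hxy)

/-- An edge-maximal graph without Hamilton path has, for some `h`, more than `h` vertices of
degree at most `h`. -/
theorem exists_low_degree_of_maximal {V : Type*} [Fintype V] [DecidableEq V] [Nonempty V]
    {G : SimpleGraph V} [DecidableRel G.Adj]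
    (hG : Maximal (fun H : SimpleGraph V => ¬ H.HasHamiltonPath) G) (hδ : ∀ v, 1 ≤ G.degree v) :
    ∃ h m, Fintype.card V = h + 2 + m ∧ 1 ≤ h ∧ h ≤ m ∧
      (∃ S : Finset V, S.card = h + 1 ∧ ∀ s ∈ S, G.degree s ≤ h) ∧
      (m = h → ∃ S : Finset V, S.card = h + 2 ∧ ∀ s ∈ S, G.degree s ≤ h) := by
  obtain ⟨u₀, v₀, hne₀, hadj₀⟩ := exists_not_adj_of_not_hasHamiltonPath hG.1
  obtain ⟨⟨u, v⟩, huv, hmax⟩ := Finset.exists_max_image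
    (Finset.univ.filter fun p : V × V => p.1 ≠ p.2 ∧ ¬ G.Adj p.1 p.2)
    (fun p => G.degree p.1 + G.degree p.2) ⟨(u₀, v₀), by simp [hne₀, hadj₀]⟩
  simp only [Finset.mem_filter, Finset.mem_univ, true_and, Prod.forall, and_imp] at huv hmax
  wlog hle : G.degree u ≤ G.degree v generalizing u v
  · exact this v u ⟨huv.1.symm, fun h => huv.2 h.symm⟩
      (fun a b h h' => (hmax a b h h').trans (add_comm _ _).le) (by omega)
  have hore := degree_add_degree_le_of_maximal hG huv.1 huv.2
  obtain ⟨m, hm⟩ := Nat.exists_eq_add_of_le (show G.degree u + 2 ≤ Fintype.card V by omega)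
  let W : Finset V := Gᶜ.neighborFinset v
  have hWdeg : ∀ s ∈ W, G.degree s ≤ G.degree u := by
    intro s hs
    have hs' : v ≠ s ∧ ¬ G.Adj v s := by simpa [W] using hs
    have := hmax s v hs'.1.symm fun h => hs'.2 h.symm
    omega
  have hWcard : W.card + G.degree v + 1 = Fintype.card V := by
    have h₁ : W.card = Gᶜ.degree v := rfl
    rw [degree_compl] at h₁
    have := G.degree_lt_card_verts v
    omega
  refine ⟨G.degree u, m, hm, hδ u, by omega, ?_, fun hmu => ?_⟩
  · obtain ⟨S, hSW, hS⟩ := Finset.exists_subset_card_eq (show G.degree u + 1 ≤ W.card by omega)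
    exact ⟨S, hS, fun s hs => hWdeg s (hSW hs)⟩
  -- Ore's bound now gives `v` itself degree at most `m = h`.
  · refine ⟨insert v W, ?_, ?_⟩
    · rw [Finset.card_insert_of_notMem (by simp [W])]
      omega
    · simp only [Finset.mem_insert, forall_eq_or_imp]
      exact ⟨by omega, hWdeg⟩

open Finset in
/-- The extremal case of the edge count with `h + 1` vertices of degree at most `h`. -/
theorem exists_adj_iff_of_low_degree {V : Type*} [Fintype V] [DecidableEq V]
    {G : SimpleGraph V} [DecidableRel G.Adj]
    (hore : ∀ u v, u ≠ v → ¬ G.Adj u v → G.degree u + G.degree v + 2 ≤ Fintype.card V) {h m : ℕ}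
    (hV : Fintype.card V = h + 2 + m) {S : Finset V} (hS : #S = h + 1)
    (hdeg : ∀ s ∈ S, G.degree s ≤ h)
    (hcard : 2 * (h * (h + 1)) + (m + 1) * m ≤ 2 * #G.edgeFinset) :
    2 * #G.edgeFinset = 2 * (h * (h + 1)) + (m + 1) * m ∧
    ∃ A : Finset V, #A = h ∧ Disjoint A S ∧
      ∀ x y, G.Adj x y ↔ x ≠ y ∧ (x ∈ A ∨ y ∈ A ∨ x ∉ S ∧ y ∉ S) := by
  have hT : #Sᶜ = m + 1 := by rw [card_compl]; omega
  have hcount := two_mul_card_edgeFinset_add G S h hdeg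
  rw [hS, hT, Nat.add_sub_cancel] at hcount
  refine ⟨by omega, ?_⟩
  have h₁ : #{p ∈ S ×ˢ S | G.Adj p.1 p.2} = 0 := by omega
  have h₂ : #{p ∈ Sᶜ.offDiag | ¬ G.Adj p.1 p.2} = 0 := by omega
  have h₃ : ∑ s ∈ S, (h - G.degree s) = 0 := by omega
  clear hcount
  have hind : ∀ x ∈ S, ∀ y ∈ S, ¬ G.Adj x y := by
    intro x hx y hy hxy
    rw [card_eq_zero, filter_eq_empty_iff] at h₁
    exact h₁ (x := (x, y)) (by simp [hx, hy]) hxy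
  have hcl : ∀ x ∉ S, ∀ y ∉ S, x ≠ y → G.Adj x y := by
    intro x hx y hy hxy
    rw [card_eq_zero, filter_eq_empty_iff] at h₂
    by_contra hn
    exact h₂ (x := (x, y)) (by simp [hx, hy, hxy]) hn
  have hdeg' : ∀ s ∈ S, G.degree s = h := by
    intro s hs
    have := (sum_eq_zero_iff.1 h₃) s hs
    have := hdeg s hs
    omega
  -- Otherwise `t` has degree at least `m + 1` and `s'` has degree `h`, against `hore`.
  have hsame : ∀ s ∈ S, ∀ s' ∈ S, ∀ t ∉ S, G.Adj s t → G.Adj s' t := by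
    intro s hs s' hs' t ht hst
    by_contra hn
    have hle := hore s' t (fun e => ht (e ▸ hs')) hn
    have hsub : insert s (Sᶜ.erase t) ⊆ G.neighborFinset t := by
      intro x hx
      rw [mem_insert, mem_erase, mem_compl] at hx
      rw [mem_neighborFinset]
      rcases hx with rfl | ⟨hxt, hx⟩
      · exact hst.symm
      · exact hcl t ht x hx hxt.symm
    have := card_le_card hsub
    rw [card_insert_of_notMem (by simp [hs]), card_erase_of_mem (by simpa using ht), hT,
      card_neighborFinset_eq_degree] at this
    have := hdeg' s' hs'
    omega
  obtain ⟨s₀, hs₀⟩ : S.Nonempty := by rw [← card_pos]; omega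
  refine ⟨G.neighborFinset s₀, hdeg' s₀ hs₀, ?_, ?_⟩
  · rw [Finset.disjoint_left]
    exact fun x hx hxS => hind s₀ hs₀ x hxS (by simpa using hx)
  · intro x y
    simp only [mem_neighborFinset]
    have hx := hind s₀ hs₀ x
    have hy := hind s₀ hs₀ y
    by_cases hxS : x ∈ S <;> by_cases hyS : y ∈ S
    · simp [hxS, hyS, hind x hxS y hyS, hx hxS, hy hyS]
    · have : x ≠ y := fun e => hyS (e ▸ hxS)
      have h' : G.Adj x y ↔ G.Adj s₀ y :=
        ⟨hsame x hxS s₀ hs₀ y hyS, hsame s₀ hs₀ x hxS y hyS⟩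
      simp [hxS, h', hx hxS, this]
    · have : x ≠ y := fun e => hxS (e ▸ hyS)
      have h' : G.Adj x y ↔ G.Adj s₀ x := by
        rw [G.adj_comm]
        exact ⟨hsame y hyS s₀ hs₀ x hxS, hsame s₀ hs₀ y hyS x hxS⟩
      simp [hyS, h', hy hyS, this]
    · simp only [hxS, hyS, not_false_eq_true, and_self, or_true, and_true]
      exact ⟨fun h => h.ne, hcl x hxS y hyS⟩

open Finset in
/-- The nearly extremal case of the edge count with `h + 2` vertices of degree at most `h`. -/
theorem not_adj_of_low_degree {V : Type*} [Fintype V] [DecidableEq V]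
    {G : SimpleGraph V} [DecidableRel G.Adj]
    (hore : ∀ u v, u ≠ v → ¬ G.Adj u v → G.degree u + G.degree v + 2 ≤ Fintype.card V) {h : ℕ}
    (hh : 2 ≤ h) (hV : Fintype.card V = 2 * h + 2) {S : Finset V} (hS : #S = h + 2)
    (hdeg : ∀ s ∈ S, G.degree s ≤ h)
    (hcard : 2 * (h * (h + 2)) + h * (h - 1) ≤ 2 * #G.edgeFinset + 2) :
    ∀ x ∈ S, ∀ y ∈ S, ¬ G.Adj x y := by
  intro a ha b hb hab
  have hT : #Sᶜ = h := by rw [card_compl]; omega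
  have hcount := two_mul_card_edgeFinset_add G S h hdeg
  rw [hS, hT] at hcount
  have hpair : #({(a, b), (b, a)} : Finset (V × V)) = 2 :=
    card_pair (by simp [hab.ne])
  have hsub : ({(a, b), (b, a)} : Finset (V × V)) ⊆ {p ∈ S ×ˢ S | G.Adj p.1 p.2} := by
    intro p hp
    simp only [mem_insert, mem_singleton] at hp
    rcases hp with rfl | rfl <;> simp [ha, hb, hab, hab.symm]
  have hle := card_le_card hsub
  -- The edge `ab` uses up the whole slack of 2, so all other defects vanish.
  have heq := eq_of_subset_of_card_le hsub (by omega)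
  have h₂ : #{p ∈ Sᶜ.offDiag | ¬ G.Adj p.1 p.2} = 0 := by omega
  have h₃ : ∑ s ∈ S, (h - G.degree s) = 0 := by omega
  have hcl : ∀ x ∉ S, ∀ y ∉ S, x ≠ y → G.Adj x y := by
    intro x hx y hy hxy
    rw [card_eq_zero, filter_eq_empty_iff] at h₂
    by_contra hn
    exact h₂ (x := (x, y)) (by simp [hx, hy, hxy]) hn
  have hdeg' : ∀ s ∈ S, G.degree s = h := by
    intro s hs
    have := (sum_eq_zero_iff.1 h₃) s hs
    have := hdeg s hs
    omega
  have hfull : ∀ s ∈ S, s ≠ a → s ≠ b → ∀ t ∉ S, G.Adj s t := by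
    intro s hs hsa hsb t ht
    have hsub' : G.neighborFinset s ⊆ Sᶜ := by
      intro x hx
      rw [mem_neighborFinset] at hx
      rw [mem_compl]
      intro hxS
      have : (s, x) ∈ ({p ∈ S ×ˢ S | G.Adj p.1 p.2} : Finset (V × V)) := by simp [hs, hxS, hx]
      rw [← heq] at this
      simp [hsa, hsb] at this
    have := eq_of_subset_of_card_le hsub' (by
      rw [card_neighborFinset_eq_degree, hdeg' s hs, hT])
    rw [← mem_neighborFinset, this, mem_compl]
    exact ht
  obtain ⟨r, hr, har⟩ : ∃ r ∉ S, ¬ G.Adj a r := by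
    by_contra! hcon
    have hsub' : insert b Sᶜ ⊆ G.neighborFinset a := by
      intro x hx
      rw [mem_insert, mem_compl] at hx
      rw [mem_neighborFinset]
      rcases hx with rfl | hx
      · exact hab
      · exact hcon x hx
    have := card_le_card hsub'
    rw [card_insert_of_notMem (by simp [hb]), card_neighborFinset_eq_degree, hT,
      hdeg' a ha] at this
    omega
  -- So `r` has degree at least `(h - 1) + h`; with degree `h` at `a` this breaks `hore` once `h ≥
  -- 2`.
  have hsub' : Sᶜ.erase r ∪ (S.erase a).erase b ⊆ G.neighborFinset r := by
    intro x hx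
    simp only [mem_union, mem_erase, mem_compl] at hx
    rw [mem_neighborFinset]
    rcases hx with ⟨hxr, hx⟩ | ⟨hxb, hxa, hx⟩
    · exact hcl r hr x hx hxr.symm
    · exact (hfull x hx hxa hxb r hr).symm
  have hle' := card_le_card hsub'
  rw [card_union_of_disjoint, card_erase_of_mem (by simpa using hr),
    card_erase_of_mem (by simp [hb, hab.ne']), card_erase_of_mem ha, hT, hS,
    card_neighborFinset_eq_degree] at hle'
  · have := hore a r (fun e => hr (e ▸ ha)) har
    have := hdeg' a ha
    omega
  · rw [Finset.disjoint_left]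
    intro x hx hx'
    simp only [mem_erase, mem_compl] at hx hx'
    exact hx.2 hx'.2.2

open Finset in
/-- A graph with an independent set of at least all but `h` vertices and with at most one edge
less than possible. -/
theorem exists_adj_iff_of_independent {V : Type*} [Fintype V] [DecidableEq V]
    {G : SimpleGraph V} [DecidableRel G.Adj] {S : Finset V}
    (hind : ∀ x ∈ S, ∀ y ∈ S, ¬ G.Adj x y)
    (hcard : 2 * (#Sᶜ * #S) + #Sᶜ * (#Sᶜ - 1) ≤ 2 * #G.edgeFinset + 2) :
    (∀ x y, G.Adj x y ↔ x ≠ y ∧ (x ∉ S ∨ y ∉ S)) ∨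
    2 * #G.edgeFinset + 2 ≤ 2 * (#Sᶜ * #S) + #Sᶜ * (#Sᶜ - 1) ∧ ∃ p q, p ∉ S ∧ p ≠ q ∧
      ∀ x y, G.Adj x y ↔ x ≠ y ∧ (x ∉ S ∨ y ∉ S) ∧ s(x, y) ≠ s(p, q) := by
  -- `K` is the largest graph in which `S` is independent; by the count, `G` lacks at most one of
  -- its edges.
  let K : SimpleGraph V :=
    { Adj x y := x ≠ y ∧ (x ∉ S ∨ y ∉ S)
      symm := ⟨fun x y h => ⟨h.1.symm, h.2.symm⟩⟩
      loopless := ⟨fun x h => h.1 rfl⟩ }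
  have : DecidableRel K.Adj := fun x y => inferInstanceAs (Decidable (x ≠ y ∧ (x ∉ S ∨ y ∉ S)))
  have hGK : G ≤ K := by
    intro x y hxy
    refine ⟨hxy.ne, ?_⟩
    by_contra! h
    exact hind x h.1 y h.2 hxy
  have hK := two_mul_card_edgeFinset_add K S #Sᶜ (by
    intro s hs
    rw [← card_neighborFinset_eq_degree]
    refine card_le_card fun x hx => ?_
    rw [mem_neighborFinset] at hx
    rcases hx.2 with h | h
    · exact absurd hs h
    · simpa using h)
  have hE : G.edgeFinset ⊆ K.edgeFinset := edgeFinset_mono hGK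
  have hsd := card_sdiff_add_card_eq_card hE
  rcases Nat.eq_zero_or_pos #(K.edgeFinset \ G.edgeFinset) with h0 | h0
  · left
    have : K = G := by
      rw [← edgeFinset_inj]
      exact (eq_of_subset_of_card_le hE (by omega)).symm
    intro x y
    rw [← this]
  · right
    refine ⟨by omega, ?_⟩
    obtain ⟨e, he⟩ := card_eq_one.1 (show #(K.edgeFinset \ G.edgeFinset) = 1 by omega)
    have hmem : ∀ x y, K.Adj x y ∧ ¬ G.Adj x y ↔ s(x, y) = e := by
      intro x y
      rw [← mem_singleton, ← he]
      simp
    induction e with | _ p q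
    have hpq := (hmem p q).2 rfl
    have key : ∀ x y, G.Adj x y ↔ x ≠ y ∧ (x ∉ S ∨ y ∉ S) ∧ s(x, y) ≠ s(p, q) := by
      intro x y
      have h₁ : K.Adj x y ↔ x ≠ y ∧ (x ∉ S ∨ y ∉ S) := Iff.rfl
      rw [← and_assoc, ← h₁, Ne, ← hmem]
      exact ⟨fun h => ⟨hGK h, fun h' => h'.2 h⟩, fun h => not_not.1 fun h' => h.2 ⟨h.1, h'⟩⟩
    rcases hpq.1.2 with hp | hq
    · exact ⟨p, q, hp, hpq.1.1, key⟩
    · refine ⟨q, p, hq, hpq.1.1.symm, ?_⟩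
      rwa [Sym2.eq_swap (a := q)]

/-! ### Structure of dense graphs without Hamilton path -/

open Finset in
/-- The structure of a dense graph without Hamilton path. -/
theorem exists_adj_iff_of_not_hasHamiltonPath {V : Type*} [Fintype V] [DecidableEq V]
    {G : SimpleGraph V} [DecidableRel G.Adj] (hV : 4 ≤ Fintype.card V) (hδ : 1 ≤ G.minDegree)
    (hm : (Fintype.card V - 2).choose 2 + 2 ≤ #G.edgeFinset) (hG : ¬ G.HasHamiltonPath) :
    (∃ h, (h = 1 ∨ h = 2 ∧ Fintype.card V = 7) ∧ ∃ A S : Finset V, #A = h ∧ #S = h + 1 ∧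
      Disjoint A S ∧ ∀ x y, G.Adj x y ↔ x ≠ y ∧ (x ∈ A ∨ y ∈ A ∨ x ∉ S ∧ y ∉ S)) ∨
    ∃ h, Fintype.card V = 2 * h + 2 ∧ ∃ S : Finset V, #S = h + 2 ∧
      ((h = 2 ∨ h = 3 ∨ h = 4) ∧ (∀ x y, G.Adj x y ↔ x ≠ y ∧ (x ∉ S ∨ y ∉ S)) ∨
      (h = 2 ∨ h = 3) ∧ ∃ p q, p ∉ S ∧ p ≠ q ∧
        ∀ x y, G.Adj x y ↔ x ≠ y ∧ (x ∉ S ∨ y ∉ S) ∧ s(x, y) ≠ s(p, q)) := by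
  classical
  have : Nonempty V := Fintype.card_pos_iff.1 (by omega)
  obtain ⟨H, hGH, hH⟩ := exists_maximal_of_not_hasHamiltonPath hG
  have hE : G.edgeFinset ⊆ H.edgeFinset := edgeFinset_mono hGH
  have hEcard := card_le_card hE
  have hδH : ∀ v, 1 ≤ H.degree v := fun v =>
    hδ.trans ((G.minDegree_le_degree v).trans (degree_le_of_le hGH))
  obtain ⟨h, m, hn, h1, hhm, ⟨S, hS, hSdeg⟩, hS'⟩ := exists_low_degree_of_maximal hH hδH
  have hore : ∀ u v, u ≠ v → ¬ H.Adj u v → H.degree u + H.degree v + 2 ≤ Fintype.card V :=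
    fun u v => degree_add_degree_le_of_maximal hH
  have hT : #Sᶜ = m + 1 := by rw [card_compl]; omega
  have hcount := two_mul_card_edgeFinset_add H S h hSdeg
  rw [hS, hT, Nat.add_sub_cancel] at hcount
  obtain ⟨k, hk⟩ : ∃ k, h + m = k + 1 := ⟨h + m - 1, by omega⟩
  have hch : 2 * (Fintype.card V - 2).choose 2 = (k + 1) * k := by
    rw [show Fintype.card V - 2 = k + 1 by omega, Nat.choose_two_right, Nat.add_sub_cancel,
      Nat.mul_div_cancel' (by simpa [mul_comm] using (Nat.even_mul_succ_self k).two_dvd)]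
  have hcases : h = 1 ∨ h = 2 ∧ m = 3 ∨ m = h ∧ (h = 2 ∨ h = 3 ∨ h = 4) := by
    by_cases hh : h = 1
    · exact .inl hh
    have hineq : (k + 1) * k + 4 ≤ 2 * (h * (h + 1)) + (m + 1) * m := by omega
    -- After substituting `k = h + m - 1`, `hineq` reads `2m(h - 1) ≤ (h + 4)(h - 1)`.
    have hle : 2 * m ≤ h + 4 := by
      zify at hineq hk ⊢
      rw [show (k : ℤ) = h + m - 1 by linarith] at hineq
      have : (2 : ℤ) ≤ h := by omega
      by_contra! hlt
      nlinarith
    have h4 : h ≤ 4 := by omega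
    have h2 : 2 ≤ h := by omega
    have h5 : m ≤ 4 := by omega
    interval_cases h <;> interval_cases m <;> simp_all
  have hA (hcard : 2 * (h * (h + 1)) + (m + 1) * m ≤ (k + 1) * k + 4) :
      ∃ A S : Finset V, #A = h ∧ #S = h + 1 ∧ Disjoint A S ∧
        ∀ x y, G.Adj x y ↔ x ≠ y ∧ (x ∈ A ∨ y ∈ A ∨ x ∉ S ∧ y ∉ S) := by
    obtain ⟨heq, A, hA, hAS, hadj⟩ :=
      exists_adj_iff_of_low_degree hore hn hS hSdeg (by omega)
    obtain rfl : G = H := by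
      rw [← edgeFinset_inj]
      exact eq_of_subset_of_card_le hE (by omega)
    exact ⟨A, S, hA, hS, hAS, hadj⟩
  have hB (hmh : m = h) (h2 : 2 ≤ h)
      (hcard : 2 * (h * (h + 2)) + h * (h - 1) ≤ (k + 1) * k + 4 + 2) :
      ∃ S : Finset V, #S = h + 2 ∧ ((∀ x y, G.Adj x y ↔ x ≠ y ∧ (x ∉ S ∨ y ∉ S)) ∨
      (k + 1) * k + 6 ≤ 2 * (h * (h + 2)) + h * (h - 1) ∧ ∃ p q, p ∉ S ∧ p ≠ q ∧
        ∀ x y, G.Adj x y ↔ x ≠ y ∧ (x ∉ S ∨ y ∉ S) ∧ s(x, y) ≠ s(p, q)) := by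
    obtain ⟨S, hS, hSdeg⟩ := hS' hmh
    have hind := not_adj_of_low_degree hore h2 (by omega) hS hSdeg (by omega)
    have hT : #Sᶜ = h := by rw [card_compl]; omega
    have := exists_adj_iff_of_independent (G := G) (S := S)
      (fun x hx y hy hxy => hind x hx y hy (hGH hxy)) (by rw [hS, hT]; omega)
    rw [hS, hT] at this
    refine ⟨S, hS, this.imp_right fun ⟨h₁, h₂⟩ => ⟨by omega, h₂⟩⟩
  rcases hcases with rfl | ⟨rfl, rfl⟩ | ⟨rfl, rfl | rfl | rfl⟩
  · refine .inl ⟨1, .inl rfl, hA ?_⟩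
    obtain rfl : m = k := by omega
    nlinarith
  · obtain rfl : k = 4 := by omega
    exact .inl ⟨2, .inr ⟨rfl, hn⟩, hA (by norm_num)⟩
  · obtain rfl : k = 3 := by omega
    obtain ⟨S, hS, h⟩ := hB rfl (by norm_num) (by norm_num)
    exact .inr ⟨2, hn, S, hS, h.imp (fun h => ⟨by simp, h⟩) fun h => ⟨by simp, h.2⟩⟩
  · obtain rfl : k = 5 := by omega
    obtain ⟨S, hS, h⟩ := hB rfl (by norm_num) (by norm_num)
    exact .inr ⟨3, hn, S, hS, h.imp (fun h => ⟨by simp, h⟩) fun h => ⟨by simp, h.2⟩⟩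
  · obtain rfl : k = 7 := by omega
    obtain ⟨S, hS, h⟩ := hB rfl (by norm_num) (by norm_num)
    -- For `h = 4` the edge bound is already the maximum 30, so no edge can be missing.
    exact .inr ⟨4, hn, S, hS, .inl ⟨by simp, h.resolve_right fun h => by simp at h⟩⟩

/-! ### Recognising the nine graphs by colour classes -/

section Colorings

variable {V : Type*} [Fintype V] [DecidableEq V] {G : SimpleGraph V}

/-- The adjacency of the classes `A, B, C` in `A ∨ (B + C)` with `A`, `B` cliques. -/
def cliqueJoinRel (i j : Fin 3) : Prop := i = 0 ∨ j = 0 ∨ i = 1 ∧ j = 1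

/-- The adjacency of the classes in `A ∨ (B ∨ C)` with `A` a clique and `B`, `C` independent. -/
def bipartiteJoinRel (i j : Fin 3) : Prop :=
  i = 0 ∨ j = 0 ∨ i = 1 ∧ j = 2 ∨ i = 2 ∧ j = 1

/-- The adjacency of the classes in `A ∨ ((B ∨ C) + D)` with `A` a clique and `B`, `C`, `D`
independent. -/
def starJoinRel (i j : Fin 4) : Prop :=
  i = 0 ∨ j = 0 ∨ i = 1 ∧ j = 2 ∨ i = 2 ∧ j = 1

open Finset in
theorem exists_coloring_cliqueJoinRel {A S : Finset V} (hAS : Disjoint A S)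
    (hG : ∀ x y, G.Adj x y ↔ x ≠ y ∧ (x ∈ A ∨ y ∈ A ∨ x ∉ S ∧ y ∉ S)) :
    ∃ c : V → Fin 3, (∀ x y, G.Adj x y ↔ x ≠ y ∧ cliqueJoinRel (c x) (c y)) ∧
      #{v | c v = 0} = #A ∧ #{v | c v = 1} = Fintype.card V - (#A + #S) ∧
      #{v | c v = 2} = #S := by
  rw [Finset.disjoint_left] at hAS
  refine ⟨fun v => if v ∈ A then 0 else if v ∈ S then 2 else 1, fun x y => ?_, ?_, ?_, ?_⟩
  · rw [hG]
    simp only [cliqueJoinRel]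
    grind
  · congr 1; ext v; grind
  · rw [← card_union_of_disjoint (Finset.disjoint_left.2 hAS), ← card_compl]
    congr 1; ext v; grind [mem_compl]
  · congr 1; ext v; grind

open Finset in
theorem exists_coloring_join_independent {S : Finset V}
    (hG : ∀ x y, G.Adj x y ↔ x ≠ y ∧ (x ∉ S ∨ y ∉ S)) :
    ∃ c : V → Fin 2, (∀ x y, G.Adj x y ↔ x ≠ y ∧ (c x = 0 ∨ c y = 0)) ∧
      #{v | c v = 0} = Fintype.card V - #S ∧ #{v | c v = 1} = #S := by
  refine ⟨fun v => if v ∈ S then 1 else 0, fun x y => ?_, ?_, ?_⟩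
  · rw [hG]
    grind
  · rw [← card_compl]
    congr 1; ext v; grind [mem_compl]
  · congr 1; ext v; grind

open Finset in
-- The ends of a missing edge inside the clique form an independent class joined to everything else.
theorem exists_coloring_bipartiteJoinRel {S : Finset V} {p q : V} (hp : p ∉ S) (hq : q ∉ S)
    (hpq : p ≠ q) (hG : ∀ x y, G.Adj x y ↔ x ≠ y ∧ (x ∉ S ∨ y ∉ S) ∧ s(x, y) ≠ s(p, q)) :
    ∃ c : V → Fin 3, (∀ x y, G.Adj x y ↔ x ≠ y ∧ bipartiteJoinRel (c x) (c y)) ∧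
      #{v | c v = 0} = Fintype.card V - (#S + 2) ∧ #{v | c v = 1} = 2 ∧
      #{v | c v = 2} = #S := by
  refine ⟨fun v => if v ∈ S then 2 else if v = p ∨ v = q then 1 else 0,
    fun x y => ?_, ?_, ?_, ?_⟩
  · rw [hG]
    simp only [bipartiteJoinRel, ne_eq, Sym2.eq_iff]
    grind
  · have hc : #(S ∪ {p, q}) = #S + 2 := by
      rw [card_union_of_disjoint (by simp [hp, hq]), card_pair hpq]
    rw [← hc, ← card_compl]
    congr 1; ext v; grind [mem_compl]
  · refine Eq.trans ?_ (card_pair hpq)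
    congr 1; ext v; grind
  · congr 1; ext v; grind

open Finset in
-- With a missing edge between clique and `S`, `p` is the centre of a star with leaves `S \ {q}`,
-- and `q` is the extra isolated vertex.
theorem exists_coloring_starJoinRel {S : Finset V} {p q : V} (hp : p ∉ S) (hq : q ∈ S)
    (hG : ∀ x y, G.Adj x y ↔ x ≠ y ∧ (x ∉ S ∨ y ∉ S) ∧ s(x, y) ≠ s(p, q)) :
    ∃ c : V → Fin 4, (∀ x y, G.Adj x y ↔ x ≠ y ∧ starJoinRel (c x) (c y)) ∧
      #{v | c v = 0} = Fintype.card V - (#S + 1) ∧ #{v | c v = 1} = 1 ∧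
      #{v | c v = 2} = #S - 1 ∧ #{v | c v = 3} = 1 := by
  refine ⟨fun v => if v = p then 1 else if v = q then 3 else if v ∈ S then 2 else 0,
    fun x y => ?_, ?_, ?_, ?_, ?_⟩
  · rw [hG]
    simp only [starJoinRel, ne_eq, Sym2.eq_iff]
    grind
  · rw [← card_insert_of_notMem hp, ← card_compl]
    congr 1; ext v; grind [mem_compl]
  · refine Eq.trans ?_ (card_singleton p)
    congr 1; ext v; grind
  · rw [← card_erase_of_mem hq]
    congr 1; ext v; grind
  · refine Eq.trans ?_ (card_singleton q)
    congr 1; ext v; grind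

end Colorings

open Finset in
theorem card_filter_sumElim {V W κ : Type*} [Fintype V] [Fintype W] [DecidableEq κ]
    (f : V → κ) (g : W → κ) (k : κ) :
    #{w | Sum.elim f g w = k} = #{v | f v = k} + #{w | g w = k} := by
  rw [card_filter, card_filter, card_filter, Fintype.sum_sum_type]
  rfl

theorem isExceptional_of_not_hasHamiltonPath {V : Type*} [Fintype V] [DecidableEq V]
    {G : SimpleGraph V} [DecidableRel G.Adj] (hV : 4 ≤ Fintype.card V) (hδ : 1 ≤ G.minDegree)
    (hm : (Fintype.card V - 2).choose 2 + 2 ≤ G.edgeFinset.card) (hG : ¬ G.HasHamiltonPath) :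
    IsExceptional (Fintype.card V) G := by
  rcases exists_adj_iff_of_not_hasHamiltonPath hV hδ hm hG with
    ⟨h, hh, A, S, hA, hS, hAS, hadj⟩ | ⟨h, hn, S, hS, ⟨hh, hadj⟩ | ⟨hh, p, q, hp, hpq, hadj⟩⟩
  · obtain ⟨c, hc, h0, h1, h2⟩ := exists_coloring_cliqueJoinRel hAS hadj
    rcases hh with rfl | ⟨rfl, hn⟩
    · refine .inl (nonempty_iso_of_coloring _ c
        (Sum.elim (fun _ => 0) (Sum.elim (fun _ => 1) (fun _ => 2))) hc ?_ ?_)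
      · rintro (x | x | x) (y | y | y) <;>
          simp [join, cliqueJoinRel]
      · rw [Fin.forall_fin_succ, Fin.forall_fin_succ, Fin.forall_fin_succ]
        simp [card_filter_sumElim, h0, h1, h2, hA, hS]
    · refine .inr (.inr (.inr (.inr (.inl (nonempty_iso_of_coloring _ c
        (Sum.elim (fun _ => 0) (Sum.elim (fun _ => 2) (fun _ => 1))) hc ?_ ?_)))))
      · rintro (x | x | x) (y | y | y) <;>
          simp [join, cliqueJoinRel]
      · rw [Fin.forall_fin_succ, Fin.forall_fin_succ, Fin.forall_fin_succ]
        simp [card_filter_sumElim, h0, h1, h2, hA, hS, hn]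
  · obtain ⟨c, hc, h0, h1⟩ := exists_coloring_join_independent hadj
    have key (m : ℕ) (hm : h = m) : Nonempty (G ≃g (completeG m).join (edgelessG (m + 2))) := by
      subst hm
      refine nonempty_iso_of_coloring (fun i j => i = 0 ∨ j = 0) c
        (Sum.elim (fun _ => 0) (fun _ => 1)) hc ?_ ?_
      · rintro (x | x) (y | y) <;> simp [join]
      · rw [Fin.forall_fin_two, h0, h1, hS, hn]
        simp [card_filter_sumElim]
        omega
    rcases hh with hh | hh | hh
    · exact .inr (.inr (.inr (.inl (key 2 hh))))
    · exact .inr (.inr (.inr (.inr (.inr (.inr (.inl (key 3 hh)))))))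
    · exact .inr (.inr (.inr (.inr (.inr (.inr (.inr (.inr (key 4 hh))))))))
  · by_cases hq : q ∈ S
    · obtain ⟨c, hc, h0, h1, h2, h3⟩ := exists_coloring_starJoinRel hp hq hadj
      have key (m : ℕ) (hm : h = m + 1) :
          Nonempty (G ≃g (completeG m).join (completeBipG 1 (m + 2) ⊕g completeG 1)) := by
        subst hm
        refine nonempty_iso_of_coloring _ c (Sum.elim (fun _ => 0)
          (Sum.elim (Sum.elim (fun _ => 1) (fun _ => 2)) (fun _ => 3))) hc ?_ ?_
        · rintro (x | (x | x) | x) (y | (y | y) | y) <;>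
            simp [join, starJoinRel, eq_iff_true_of_subsingleton]
        · rw [Fin.forall_fin_succ, Fin.forall_fin_succ, Fin.forall_fin_succ, Fin.forall_fin_succ]
          simp [card_filter_sumElim, h0, h1, h2, h3, hS, hn]
          omega
      rcases hh with hh | hh
      · exact .inr (.inl (key 1 hh))
      · exact .inr (.inr (.inr (.inr (.inr (.inr (.inr (.inl (key 2 hh))))))))
    · obtain ⟨c, hc, h0, h1, h2⟩ := exists_coloring_bipartiteJoinRel hp hq hpq hadj
      rcases hh with rfl | rfl
      -- For `h = 2` class 0 is empty, which leaves `K_{2,4}`.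
      · refine .inr (.inr (.inl (nonempty_iso_of_coloring _ c
          (Sum.elim (fun _ => 1) (fun _ => 2)) hc ?_ ?_)))
        · rintro (x | x) (y | y) <;> simp [bipartiteJoinRel]
        · rw [Fin.forall_fin_succ, Fin.forall_fin_succ, Fin.forall_fin_succ]
          simp [card_filter_sumElim, h0, h1, h2, hS, hn]
      · refine .inr (.inr (.inr (.inr (.inr (.inl (nonempty_iso_of_coloring _ c
          (Sum.elim (fun _ => 0) (Sum.elim (fun _ => 1) (fun _ => 2))) hc ?_ ?_))))))
        · rintro (x | x | x) (y | y | y) <;>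
            simp [join, bipartiteJoinRel]
        · rw [Fin.forall_fin_succ, Fin.forall_fin_succ, Fin.forall_fin_succ]
          simp [card_filter_sumElim, h0, h1, h2, hS, hn]

/-! ### The exceptional graphs have no Hamilton path -/

/-- The deleted set is the clique being joined, together with the star centre or the 2-element part
where there is one; for `K_{2,4}` it is the 2-element part. It leaves two more components than it
has vertices. -/
theorem not_hasHamiltonPath_of_isExceptional {V : Type*} [DecidableEq V] {G : SimpleGraph V}
    {n : ℕ} (hn : 4 ≤ n) (hG : IsExceptional n G) : ¬ G.HasHamiltonPath := by
  have key (m : ℕ) (e : Nonempty (G ≃g (completeG m).join (edgelessG (m + 2)))) :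
      ¬ G.HasHamiltonPath := by
    refine not_hasHamiltonPath_of_iso e (Sum.elim (fun _ => none) some) ?_ ?_ ?_
    · rintro (x | x) (y | y) a b h ha hb <;> simp_all [join]
    · exact fun a => ⟨.inr a, rfl⟩
    · refine (Nat.succ_le_succ (Fintype.card_le_of_surjective
        (fun x : Fin m => ⟨.inl x, rfl⟩) ?_)).trans_lt (by simp)
      rintro ⟨x | x, hx⟩
      · exact ⟨x, rfl⟩
      · cases hx
  rcases hG with e | e | e | e | e | e | e | e | e
  · refine not_hasHamiltonPath_of_iso (κ := Fin 3) e (Sum.elim (fun _ => none)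
      (Sum.elim (fun _ => some 0) (fun x => some x.succ))) ?_ ?_ ?_
    · rintro (x | x | x) (y | y | y) a b h ha hb <;> simp_all [join]
    · rw [Fin.forall_fin_succ]
      -- `n ≥ 4` makes `K_{n-3}` nonempty, so it counts as a third component.
      exact ⟨⟨.inr (.inl ⟨0, by omega⟩), rfl⟩, fun x => ⟨.inr (.inr x), rfl⟩⟩
    · refine (Nat.succ_le_succ (Fintype.card_le_of_surjective
        (fun x : Fin 1 => ⟨.inl x, rfl⟩) ?_)).trans_lt (by simp)
      rintro ⟨x | x | x, hx⟩
      · exact ⟨x, rfl⟩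
      · cases hx
      · cases hx
  · refine not_hasHamiltonPath_of_iso (κ := Fin 4) e (Sum.elim (fun _ => none)
      (Sum.elim (Sum.elim (fun _ => none) (fun x => some x.castSucc)) (fun _ => some 3)))
      ?_ (by decide) (by decide)
    rintro (x | (x | x) | x) (y | (y | y) | y) a b h ha hb <;>
      first
      | exact Option.some.inj (ha.symm.trans hb)
      | (simp at ha; done)
      | (simp at hb; done)
      | simp [join] at h
  · refine not_hasHamiltonPath_of_iso e (Sum.elim (fun _ => none) some) ?_ (by decide) (by decide)
    rintro (x | x) (y | y) a b h ha hb <;> simp_all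
  · exact key 2 e
  · refine not_hasHamiltonPath_of_iso (κ := Fin 4) e (Sum.elim (fun _ => none)
      (Sum.elim (fun x => some x.castSucc) (fun _ => some 3))) ?_ (by decide) (by decide)
    rintro (x | x | x) (y | y | y) a b h ha hb <;> simp_all [join]
  · refine not_hasHamiltonPath_of_iso e (Sum.elim (fun _ => none)
      (Sum.elim (fun _ => none) some)) ?_ (by decide) (by decide)
    rintro (x | x | x) (y | y | y) a b h ha hb <;> simp_all [join]
  · exact key 3 e
  · refine not_hasHamiltonPath_of_iso (κ := Fin 5) e (Sum.elim (fun _ => none)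
      (Sum.elim (Sum.elim (fun _ => none) (fun x => some x.castSucc)) (fun _ => some 4)))
      ?_ (by decide) (by decide)
    rintro (x | (x | x) | x) (y | (y | y) | y) a b h ha hb <;>
      first
      | exact Option.some.inj (ha.symm.trans hb)
      | (simp at ha; done)
      | (simp at hb; done)
      | simp [join] at h
  · exact key 4 e

end SimpleGraph

theorem lemma4 {V : Type*} [Fintype V] [DecidableEq V] (G : SimpleGraph V) [DecidableRel G.Adj]
    (n : ℕ) (hV : Fintype.card V = n) (hn : 4 ≤ n) (hδ : 1 ≤ G.minDegree)
    (hm : (n - 2).choose 2 + 2 ≤ G.edgeFinset.card) :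
    G.HasHamiltonPath ↔ ¬ IsExceptional n G := by
  subst hV
  refine ⟨fun h he => SimpleGraph.not_hasHamiltonPath_of_isExceptional hn he h, fun h => ?_⟩
  by_contra hG
  exact h (SimpleGraph.isExceptional_of_not_hasHamiltonPath hn hδ hm hG)
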